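/- Let $N\ge 1$, let $\Omega\subset\mathbb R^N$ be a bounded open set, let $p>1$ and $p'=\frac{p}{p-1}$. Let $W_0^{1,p}(\Omega)$ be the closure of $C_c^\infty(\Omega)$ in $W^{1,p}(\Omega)$. A real number $\lambda$ is an eigenvalue of the $p$-Laplacian if there is a nonzero $u\in W^{1,p}_0(\Omega)$ with $-\mathrm{div}(|\nabla u|^{p-2}\nabla u)=\lambda|u|^{p-2}u$ in $\Omega$ in the sense of distributions; such a $u$ is called an eigenfunction for $\lambda$. Let $\lambda_p$ be the first (smallest) eigenvalue, let $u_p$ be an eigenfunction for $\lambda_p$ with $u_p>0$ a.e. in $\Omega$ and $\int_\Omega u_p^p\,dx=1$, and put $f_p:=u_p^{p-1}$. Consider $$(\mathcal P_p)\qquad \min_{v\in W^{1,p}_0(\Omega)}\Big\{\frac1{p\lambda_p}\int_\Omega|\nabla v|^p\,dx-\int_\Omega f_p v\,dx\Big\},$$ $$(\mathcal P_p^*)\qquad \min_{\sigma\in L^{p'}(\mathbb R^N;\mathbb R^N)}\Big\{\frac1{p'}\lambda_p^{p'-1}\int_{\overline\Omega}|\sigma|^{p'}dx:\ \mathrm{spt}(\sigma)\subset\overline\Omega,\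 -\mathrm{div}\,\sigma\in\mathcal M_b(\mathbb R^N),\ -\mathrm{div}\,\sigma=f_p\text{ in }\Omega\Big\},$$ where $\mathcal M_b(\mathbb R^N)$ is the set of finite signed Borel measures and the conditions on $-\mathrm{div}\,\sigma$ are in the sense of distributions, on $\mathbb R^N$ and in $\Omega$ respectively. Then both minima are attained, and $$\min(\mathcal P_p)=-\min(\mathcal P_p^*).$$ -/

import Mathlib

open MeasureTheory Filter Topology
open scoped ContDiff

noncomputable section

namespace PLaplace

/-- `ℝ^N` with its Euclidean structure. -/
abbrev Euc (N : ℕ) : Type := EuclideanSpace ℝ (Fin N)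

variable {N : ℕ}

/-- `φ ∈ C_c^∞(Ω)`: smooth, with compact support contained in `Ω`. -/
structure IsTest (Ω : Set (Euc N)) (φ : Euc N → ℝ) : Prop where
  smooth : ContDiff ℝ ∞ φ
  compact : HasCompactSupport φ
  supp : tsupport φ ⊆ Ω

/-- `v ∈ W^{1,p}(Ω)` with weak gradient `G`. -/
structure MemW (Ω : Set (Euc N)) (p : ℝ) (v : Euc N → ℝ) (G : Euc N → Euc N) : Prop where
  memLp : MemLp v (ENNReal.ofReal p) (volume.restrict Ω)
  memLp_grad : MemLp G (ENNReal.ofReal p) (volume.restrict Ω)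
  weakGrad : ∀ φ : Euc N → ℝ, IsTest Ω φ → ∀ e : Euc N,
    ∫ x in Ω, v x * inner ℝ (gradient φ x) e = -∫ x in Ω, φ x * inner ℝ (G x) e

/-- `v ∈ W_0^{1,p}(Ω)` with weak gradient `G`: `v` belongs to the closure of `C_c^∞(Ω)` in
`W^{1,p}(Ω)`. -/
structure MemWZero (Ω : Set (Euc N)) (p : ℝ) (v : Euc N → ℝ) (G : Euc N → Euc N) : Prop
    extends MemW Ω p v G where
  approx : ∃ φ : ℕ → Euc N → ℝ, (∀ n, IsTest Ω (φ n)) ∧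
    Tendsto (fun n => eLpNorm (fun x => v x - φ n x) (ENNReal.ofReal p) (volume.restrict Ω))
      atTop (𝓝 0) ∧
    Tendsto (fun n => eLpNorm (fun x => G x - gradient (φ n) x) (ENNReal.ofReal p)
      (volume.restrict Ω)) atTop (𝓝 0)

/-- `u` (with weak gradient `G`) is an eigenfunction of the `p`-Laplacian for `lam`: a nonzero
element of `W_0^{1,p}(Ω)` with `-div (|∇u|^{p-2} ∇u) = lam |u|^{p-2} u` in the sense of
distributions in `Ω`. -/
structure IsEigenfunction (Ω : Set (Euc N)) (p lam : ℝ) (u : Euc N → ℝ) (G : Euc N → Euc N) :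
    Prop where
  mem : MemWZero Ω p u G
  nonzero : ¬ (u =ᵐ[volume.restrict Ω] 0)
  weakEq : ∀ φ : Euc N → ℝ, IsTest Ω φ →
    ∫ x in Ω, ‖G x‖ ^ (p - 2) * inner ℝ (G x) (gradient φ x) =
      lam * ∫ x in Ω, |u x| ^ (p - 2) * u x * φ x

/-- `lam` is an eigenvalue of the `p`-Laplacian in `Ω` with zero boundary values. -/
def IsEigenvalue (Ω : Set (Euc N)) (p lam : ℝ) : Prop :=
  ∃ (u : Euc N → ℝ) (G : Euc N → Euc N), IsEigenfunction Ω p lam u G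

/-- The first (smallest) eigenvalue `λ_p` of the `p`-Laplacian in `Ω`. -/
def firstEigenvalue (Ω : Set (Euc N)) (p : ℝ) : ℝ :=
  sInf {lam : ℝ | IsEigenvalue Ω p lam}

/-- `u` is a first eigenfunction `u_p`: it is positive in `Ω` and satisfies `‖u‖_{L^p(Ω)} = 1`. -/
def IsFirstEigenfunction (Ω : Set (Euc N)) (p : ℝ) (u : Euc N → ℝ) : Prop :=
  (∃ G : Euc N → Euc N, IsEigenfunction Ω p (firstEigenvalue Ω p) u G) ∧
  (∀ᵐ x ∂(volume.restrict Ω), 0 < u x) ∧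
  ∫ x in Ω, u x ^ p = 1

/-- The values of the primal problem: `(1 / (p λ_p)) ∫_Ω |∇v|^p - ∫_Ω f v` for
`v ∈ W_0^{1,p}(Ω)`. -/
def primalValues (Ω : Set (Euc N)) (p : ℝ) (f : Euc N → ℝ) : Set ℝ :=
  {t | ∃ (v : Euc N → ℝ) (G : Euc N → Euc N), MemWZero Ω p v G ∧
    t = 1 / (p * firstEigenvalue Ω p) * (∫ x in Ω, ‖G x‖ ^ p) - ∫ x in Ω, f x * v x}

/-- `-div σ` is a finite signed Borel measure on `ℝ^N`, written as a difference `μ - ν` of two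
finite positive measures, in the sense of distributions. -/
def NegDivIsFiniteMeasure (σ : Euc N → Euc N) : Prop :=
  ∃ μ ν : Measure (Euc N), IsFiniteMeasure μ ∧ IsFiniteMeasure ν ∧
    ∀ φ : Euc N → ℝ, IsTest Set.univ φ →
      ∫ x, inner ℝ (gradient φ x) (σ x) = (∫ x, φ x ∂μ) - ∫ x, φ x ∂ν

/-- `-div σ = f` in `Ω`, in the sense of distributions. -/
def NegDivEq (Ω : Set (Euc N)) (σ : Euc N → Euc N) (f : Euc N → ℝ) : Prop :=
  ∀ φ : Euc N → ℝ, IsTest Ω φ →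
    ∫ x, inner ℝ (gradient φ x) (σ x) = ∫ x in Ω, φ x * f x

/-- Admissible fields of the dual problem; `q` is the exponent conjugate to `p`. -/
structure IsAdmissible (Ω : Set (Euc N)) (q : ℝ) (f : Euc N → ℝ) (σ : Euc N → Euc N) :
    Prop where
  memLp : MemLp σ (ENNReal.ofReal q) volume
  supp : ∀ᵐ x ∂(volume : Measure (Euc N)), x ∉ closure Ω → σ x = 0
  divMeasure : NegDivIsFiniteMeasure σ
  divEq : NegDivEq Ω σ f

/-- The values of the dual problem: `(1/p') λ_p^{p'-1} ∫_{closure Ω} |σ|^{p'}` over all admissible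
fields, with `p' = p / (p - 1)`. -/
def dualValues (Ω : Set (Euc N)) (p : ℝ) (f : Euc N → ℝ) : Set ℝ :=
  {t | ∃ σ : Euc N → Euc N, IsAdmissible Ω (p / (p - 1)) f σ ∧
    t = 1 / (p / (p - 1)) * firstEigenvalue Ω p ^ (p / (p - 1) - 1) *
      ∫ x in closure Ω, ‖σ x‖ ^ (p / (p - 1))}

end PLaplace

end

/-!
Testing `-div σ = f` against `v ∈ W_0^{1,p}(Ω)` and applying Young's inequality pointwise to
`σ · ∇v` gives weak duality, with equality at `v = u` and at `σ = λ⁻¹ |∇u|^{p-2} ∇u`, extended by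
zero.

The point is that this `σ` is admissible, i.e. that its divergence on the whole space is a finite
measure, whatever happens at the boundary of `Ω`. If the test function `φ ≥ 0` does not vanish
there, `φ arctan (k u)` can still be inserted in the eigenvalue equation. The term containing the
derivative of `arctan (k u)` is nonnegative, and letting `k → ∞` in the rest yields
`-div σ ≤ u^{p-1} χ_Ω` on `ℝ^N`. The nonnegative distribution `u^{p-1} χ_Ω + div σ` is a measure,
and testing with cutoff functions of bounded gradient bounds its mass, as `σ ∈ L¹`.
-/

noncomputable section

namespace PLaplace

section Lebesgue

variable {α E : Type*} [MeasurableSpace α] {μ : Measure α} [NormedAddCommGroup E]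

theorem integrable_norm_rpow_of_memLp {p : ℝ} {G : α → E} (hp : 0 < p)
    (hG : MemLp G (ENNReal.ofReal p) μ) : Integrable (fun x => ‖G x‖ ^ p) μ := by
  simpa only [ENNReal.toReal_ofReal hp.le] using
    hG.integrable_norm_rpow (by simpa using hp) ENNReal.ofReal_ne_top

theorem tendsto_eLpNorm_zero_of_dominated {p : ENNReal} (hp₀ : p ≠ 0) (hp : p ≠ ⊤)
    {f : ℕ → α → E} {g : α → ℝ} (hf : ∀ n, AEStronglyMeasurable (f n) μ) (hg : MemLp g p μ)
    (hfg : ∀ n, ∀ᵐ x ∂μ, ‖f n x‖ ≤ g x) (hlim : ∀ᵐ x ∂μ, Tendsto (fun n => f n x) atTop (𝓝 0)) :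
    Tendsto (fun n => eLpNorm (f n) p μ) atTop (𝓝 0) := by
  have hp' : 0 < p.toReal := ENNReal.toReal_pos hp₀ hp
  have hint : Tendsto (fun n => ∫⁻ x, ‖f n x‖ₑ ^ p.toReal ∂μ) atTop (𝓝 (∫⁻ _, 0 ∂μ)) := by
    refine tendsto_lintegral_of_dominated_convergence' (fun x => ‖g x‖ₑ ^ p.toReal)
      (fun n => (hf n).enorm.pow_const _) (fun n => ?_)
      (lintegral_rpow_enorm_lt_top_of_eLpNorm_lt_top hp₀ hp hg.2).ne ?_
    · filter_upwards [hfg n] with x hx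
      gcongr
      exact enorm_le_iff_norm_le.2 (hx.trans (le_abs_self _))
    · filter_upwards [hlim] with x hx
      simpa [ENNReal.zero_rpow_of_pos hp'] using hx.enorm.ennrpow_const p.toReal
  simpa [eLpNorm_eq_lintegral_rpow_enorm_toReal hp₀ hp, ENNReal.zero_rpow_of_pos (inv_pos.2 hp')]
    using hint.ennrpow_const (1 / p.toReal)

theorem tendsto_eLpNorm_smul_sub_smul [NormedSpace ℝ E] {p : ENNReal} (hp₁ : 1 ≤ p) (hp : p ≠ ⊤)
    {b : ℕ → α → ℝ} {b' : α → ℝ} {w : ℕ → α → E} {w' : α → E} {C : ℝ}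
    (hb : ∀ n, AEStronglyMeasurable (b n) μ) (hbC : ∀ n x, ‖b n x‖ ≤ C)
    (hb' : AEStronglyMeasurable b' μ) (hb'C : ∀ x, ‖b' x‖ ≤ C)
    (hblim : ∀ᵐ x ∂μ, Tendsto (fun n => b n x) atTop (𝓝 (b' x)))
    (hw : ∀ n, MemLp (w n) p μ) (hw' : MemLp w' p μ)
    (hwlim : Tendsto (fun n => eLpNorm (fun x => w' x - w n x) p μ) atTop (𝓝 0)) :
    Tendsto (fun n => eLpNorm (fun x => b' x • w' x - b n x • w n x) p μ) atTop (𝓝 0) := by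
  have hcoef : Tendsto (fun n => eLpNorm (fun x => (b' x - b n x) • w' x) p μ) atTop (𝓝 0) := by
    refine tendsto_eLpNorm_zero_of_dominated (by positivity) hp
      (fun n => (hb'.sub (hb n)).smul hw'.1) (hw'.norm.const_mul (C + C))
      (fun n => .of_forall fun x => ?_) ?_
    · rw [norm_smul]
      gcongr
      exact (norm_sub_le _ _).trans (add_le_add (hb'C x) (hbC n x))
    · filter_upwards [hblim] with x hx
      simpa using (hx.const_sub (b' x)).smul_const (w' x)
  have hbound : Tendsto (fun n => eLpNorm (fun x => (b' x - b n x) • w' x) p μ +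
      ENNReal.ofReal C * eLpNorm (fun x => w' x - w n x) p μ) atTop (𝓝 0) := by
    simpa using hcoef.add (ENNReal.Tendsto.const_mul hwlim (.inr ENNReal.ofReal_ne_top))
  refine tendsto_of_tendsto_of_tendsto_of_le_of_le tendsto_const_nhds hbound (fun _ => zero_le)
    fun n => ?_
  calc eLpNorm (fun x => b' x • w' x - b n x • w n x) p μ
      = eLpNorm ((fun x => (b' x - b n x) • w' x) + fun x => b n x • (w' x - w n x)) p μ := by
        congr 1
        ext x
        simp only [Pi.add_apply]
        module
    _ ≤ eLpNorm (fun x => (b' x - b n x) • w' x) p μ +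
          eLpNorm (fun x => b n x • (w' x - w n x)) p μ :=
        eLpNorm_add_le ((hb'.sub (hb n)).smul hw'.1) ((hb n).smul (hw'.sub (hw n)).1) hp₁
    _ ≤ _ := by
        gcongr
        refine eLpNorm_le_mul_eLpNorm_of_ae_le_mul (.of_forall fun x => ?_) _
        rw [norm_smul]
        gcongr
        exact hbC n x

theorem tendsto_eLpNorm_comp_smul [NormedSpace ℝ E] {p : ENNReal} (hp₁ : 1 ≤ p) (hp : p ≠ ⊤)
    {H : ℝ → ℝ} {u : ℕ → α → ℝ} {u' : α → ℝ} {w : ℕ → α → E} {w' : α → E} {C : ℝ}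
    (hH : Continuous H) (hC : ∀ t, ‖H t‖ ≤ C) (hu : ∀ n, AEStronglyMeasurable (u n) μ)
    (hu' : AEStronglyMeasurable u' μ)
    (hulim : ∀ᵐ x ∂μ, Tendsto (fun n => u n x) atTop (𝓝 (u' x)))
    (hw : ∀ n, MemLp (w n) p μ) (hw' : MemLp w' p μ)
    (hwlim : Tendsto (fun n => eLpNorm (fun x => w' x - w n x) p μ) atTop (𝓝 0)) :
    Tendsto (fun n => eLpNorm (fun x => H (u' x) • w' x - H (u n x) • w n x) p μ) atTop (𝓝 0) :=
  tendsto_eLpNorm_smul_sub_smul hp₁ hp (fun n => hH.comp_aestronglyMeasurable (hu n))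
    (fun _ _ => hC _) (hH.comp_aestronglyMeasurable hu') (fun _ => hC _)
    (hulim.mono fun _ hx => (hH.tendsto _).comp hx) hw hw' hwlim

theorem memLp_smul_of_bounded [NormedSpace ℝ E] {p : ENNReal} {b : α → ℝ} {w : α → E} {C : ℝ}
    (hb : AEStronglyMeasurable b μ) (hC : ∀ x, ‖b x‖ ≤ C) (hw : MemLp w p μ) :
    MemLp (fun x => b x • w x) p μ :=
  hw.of_le_mul (hb.smul hw.1) (.of_forall fun x => by
    rw [norm_smul]
    gcongr
    exact hC x)

theorem tendsto_eLpNorm_add_sub_add {p : ENNReal} (hp₁ : 1 ≤ p) {f g : ℕ → α → E} {f' g' : α → E}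
    (hf : ∀ n, MemLp (f n) p μ) (hf' : MemLp f' p μ) (hg : ∀ n, MemLp (g n) p μ)
    (hg' : MemLp g' p μ)
    (hflim : Tendsto (fun n => eLpNorm (fun x => f' x - f n x) p μ) atTop (𝓝 0))
    (hglim : Tendsto (fun n => eLpNorm (fun x => g' x - g n x) p μ) atTop (𝓝 0)) :
    Tendsto (fun n => eLpNorm (fun x => f' x + g' x - (f n x + g n x)) p μ) atTop (𝓝 0) := by
  refine tendsto_of_tendsto_of_tendsto_of_le_of_le tendsto_const_nhds
    (by simpa only [add_zero] using hflim.add hglim) (fun _ => zero_le) fun n => ?_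
  simpa only [Pi.add_def, Pi.sub_apply, Pi.sub_def, add_sub_add_comm] using
    eLpNorm_add_le (hf'.sub (hf n)).1 (hg'.sub (hg n)).1 hp₁

theorem tendsto_integral_mul_of_bounded {w : α → ℝ} (hw : Integrable w μ) {b : ℕ → α → ℝ}
    {b' : α → ℝ} {C : ℝ} (hb : ∀ n, AEStronglyMeasurable (b n) μ) (hC : ∀ n x, ‖b n x‖ ≤ C)
    (hlim : ∀ᵐ x ∂μ, Tendsto (fun n => b n x) atTop (𝓝 (b' x))) :
    Tendsto (fun n => ∫ x, b n x * w x ∂μ) atTop (𝓝 (∫ x, b' x * w x ∂μ)) := by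
  refine tendsto_integral_of_dominated_convergence (fun x => C * ‖w x‖)
    (fun n => (hb n).mul hw.1) (hw.norm.const_mul C) (fun n => .of_forall fun x => ?_) ?_
  · rw [norm_mul]
    gcongr
    exact hC n x
  · filter_upwards [hlim] with x hx
    exact hx.mul_const _

theorem isFiniteMeasure_of_tendsto_one {χ : ℕ → α → ℝ} (hχ : ∀ n, Integrable (χ n) μ)
    (hχ₀ : ∀ n x, 0 ≤ χ n x) (hlim : ∀ᵐ x ∂μ, Tendsto (fun n => χ n x) atTop (𝓝 1)) {C : ℝ}
    (hC : ∀ n, ∫ x, χ n x ∂μ ≤ C) : IsFiniteMeasure μ := by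
  refine ⟨lt_of_le_of_lt ?_ (ENNReal.ofReal_lt_top (r := C))⟩
  calc μ Set.univ = ∫⁻ x, liminf (fun n => ENNReal.ofReal (χ n x)) atTop ∂μ := by
        rw [← lintegral_one]
        refine lintegral_congr_ae (hlim.mono fun x hx => ?_)
        simpa using (ENNReal.tendsto_ofReal hx).liminf_eq.symm
    _ ≤ liminf (fun n => ∫⁻ x, ENNReal.ofReal (χ n x) ∂μ) atTop :=
        lintegral_liminf_le' fun n => (hχ n).1.aemeasurable.ennreal_ofReal
    _ ≤ ENNReal.ofReal C := by
        refine liminf_le_of_le ⟨0, by simp⟩ fun b hb => ?_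
        obtain ⟨n, hn⟩ := hb.exists
        rw [← ofReal_integral_eq_lintegral_ofReal (hχ n) (.of_forall (hχ₀ n))] at hn
        exact hn.trans (ENNReal.ofReal_le_ofReal (hC n))

variable [InnerProductSpace ℝ E] {F g : α → E}

theorem integrable_inner_of_memLp {p q : ENNReal} [p.HolderConjugate q] (hF : MemLp F p μ)
    (hg : MemLp g q μ) : Integrable (fun x => inner ℝ (F x) (g x)) μ :=
  memLp_one_iff_integrable.1 ((innerSL ℝ (E := E)).memLp_of_bilin 1 hF hg)

theorem tendsto_integral_inner {p q : ENNReal} [p.HolderConjugate q] (hF : MemLp F p μ)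
    {k : ℕ → α → E} (hg : MemLp g q μ) (hk : ∀ n, MemLp (k n) q μ)
    (hlim : Tendsto (fun n => eLpNorm (fun x => g x - k n x) q μ) atTop (𝓝 0)) :
    Tendsto (fun n => ∫ x, inner ℝ (F x) (k n x) ∂μ) atTop (𝓝 (∫ x, inner ℝ (F x) (g x) ∂μ)) := by
  have : Fact (1 ≤ p) := ⟨ENNReal.HolderConjugate.one_le p q⟩
  have : Fact (1 ≤ q) := ⟨ENNReal.HolderConjugate.one_le q p⟩
  have hkg : Tendsto (fun n => (hk n).toLp (k n)) atTop (𝓝 (hg.toLp g)) := by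
    refine (Lp.tendsto_Lp_iff_tendsto_eLpNorm'' k hk g hg).2 (hlim.congr fun n => ?_)
    exact eLpNorm_sub_comm g (k n) q μ
  have hpair (h : α → E) (hh : MemLp h q μ) : (innerSL ℝ (E := E)).lpPairing μ p q (hF.toLp F)
      (hh.toLp h) = ∫ x, inner ℝ (F x) (h x) ∂μ := by
    rw [ContinuousLinearMap.lpPairing_eq_integral]
    refine integral_congr_ae ?_
    filter_upwards [hF.coeFn_toLp, hh.coeFn_toLp] with x hFx hhx
    rw [hFx, hhx, innerSL_apply_apply]
  simpa only [Function.comp_def, hpair] using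
    (((innerSL ℝ (E := E)).lpPairing μ p q (hF.toLp F)).continuous.tendsto _).comp hkg

end Lebesgue

section DualityMap

variable {E : Type*} [NormedAddCommGroup E] [NormedSpace ℝ E] {p q : ℝ}

/-- The duality map `a ↦ |a|^{p-2} a`. It is used in `ℝ^N`, where `dualityMap p (∇u x)` is the flux
of the `p`-Laplacian, and in `ℝ`, where `dualityMap p (u x)` is the right-hand side of the
eigenvalue equation. -/
def dualityMap (p : ℝ) (a : E) : E := ‖a‖ ^ (p - 2) • a

theorem norm_dualityMap (hp : 1 < p) (a : E) : ‖dualityMap p a‖ = ‖a‖ ^ (p - 1) := by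
  rw [dualityMap, norm_smul, Real.norm_of_nonneg (by positivity),
    ← Real.rpow_add_one' (norm_nonneg a) (by linarith)]
  ring_nf

theorem norm_dualityMap_rpow (hpq : p.HolderConjugate q) (a : E) :
    ‖dualityMap p a‖ ^ q = ‖a‖ ^ p := by
  rw [norm_dualityMap hpq.lt, ← Real.rpow_mul (norm_nonneg a), hpq.sub_one_mul_conj]

theorem dualityMap_of_pos {t : ℝ} (ht : 0 < t) : dualityMap p t = t ^ (p - 1) := by
  rw [dualityMap, Real.norm_of_nonneg ht.le, smul_eq_mul, ← Real.rpow_add_one ht.ne']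
  ring_nf

theorem memLp_dualityMap {α : Type*} [MeasurableSpace α] {μ : Measure α} {G : α → E}
    (hpq : p.HolderConjugate q) (hG : MemLp G (ENNReal.ofReal p) μ) :
    MemLp (fun x => dualityMap p (G x)) (ENNReal.ofReal q) μ := by
  have h := hG.norm_rpow_div (ENNReal.ofReal (p - 1))
  rw [ENNReal.toReal_ofReal hpq.sub_one_pos.le, ← ENNReal.ofReal_div_of_pos hpq.sub_one_pos,
    ← hpq.conjugate_eq] at h
  refine h.of_le ?_ (.of_forall fun x => ?_)
  · exact (hG.1.norm.aemeasurable.pow_const _).aestronglyMeasurable.smul hG.1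
  · rw [norm_dualityMap hpq.lt]
    exact le_abs_self _

end DualityMap

section InnerProduct

variable {E : Type*} [NormedAddCommGroup E] [InnerProductSpace ℝ E] {p q : ℝ}

theorem inner_dualityMap_self (hp : p ≠ 0) (a : E) : inner ℝ (dualityMap p a) a = ‖a‖ ^ p := by
  rw [dualityMap, real_inner_smul_left, real_inner_self_eq_norm_sq, ← Real.rpow_natCast,
    ← Real.rpow_add' (norm_nonneg a) (by simpa using hp)]
  simp

theorem dualityMap_mul_self (hp : p ≠ 0) (t : ℝ) : dualityMap p t * t = ‖t‖ ^ p := by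
  simpa only [RCLike.inner_apply', conj_trivial] using inner_dualityMap_self hp t

theorem inner_le_rpow_norm_add_rpow_norm (hpq : p.HolderConjugate q) {lam : ℝ} (hlam : 0 < lam)
    (s g : E) :
    inner ℝ s g ≤ 1 / (p * lam) * ‖g‖ ^ p + 1 / q * lam ^ (q - 1) * ‖s‖ ^ q := by
  have hp := hpq.ne_zero
  have hweights : lam ^ (-(1 / p)) * lam ^ (1 / p) = 1 := by
    rw [← Real.rpow_add hlam, neg_add_cancel, Real.rpow_zero]
  have hpow_p : (lam ^ (-(1 / p)) * ‖g‖) ^ p = lam⁻¹ * ‖g‖ ^ p := by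
    rw [Real.mul_rpow (by positivity) (norm_nonneg g), ← Real.rpow_mul hlam.le,
      neg_mul, one_div_mul_cancel hp, Real.rpow_neg_one]
  have hpow_q : (lam ^ (1 / p) * ‖s‖) ^ q = lam ^ (q - 1) * ‖s‖ ^ q := by
    rw [Real.mul_rpow (by positivity) (norm_nonneg s), ← Real.rpow_mul hlam.le,
      one_div_mul_eq_div, hpq.symm.div_conj_eq_sub_one]
  calc inner ℝ s g ≤ ‖s‖ * ‖g‖ := real_inner_le_norm s g
    _ = lam ^ (-(1 / p)) * ‖g‖ * (lam ^ (1 / p) * ‖s‖) := by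
      linear_combination (-(‖s‖ * ‖g‖)) * hweights
    _ ≤ (lam ^ (-(1 / p)) * ‖g‖) ^ p / p + (lam ^ (1 / p) * ‖s‖) ^ q / q :=
      Real.young_inequality_of_nonneg (by positivity) (by positivity) hpq
    _ = 1 / (p * lam) * ‖g‖ ^ p + 1 / q * lam ^ (q - 1) * ‖s‖ ^ q := by
      rw [hpow_p, hpow_q]
      field_simp

end InnerProduct

section Arctan

theorem norm_arctan_le (t : ℝ) : ‖Real.arctan t‖ ≤ Real.pi / 2 :=
  abs_le.2 ⟨(Real.neg_pi_div_two_lt_arctan t).le, (Real.arctan_lt_pi_div_two t).le⟩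

theorem deriv_arctan_const_mul (k t : ℝ) :
    deriv (fun s => Real.arctan (k * s)) t = (1 + (k * t) ^ 2)⁻¹ * k := by
  simpa using (((hasDerivAt_id t).const_mul k).arctan).deriv

theorem deriv_arctan_const_mul_nonneg {k : ℝ} (hk : 0 ≤ k) (t : ℝ) :
    0 ≤ deriv (fun s => Real.arctan (k * s)) t := by
  rw [deriv_arctan_const_mul]
  positivity

theorem norm_deriv_arctan_const_mul_le (k t : ℝ) :
    ‖deriv (fun s => Real.arctan (k * s)) t‖ ≤ ‖k‖ := by
  rw [deriv_arctan_const_mul, norm_mul, Real.norm_of_nonneg (by positivity)]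
  exact mul_le_of_le_one_left (norm_nonneg k)
    (inv_le_one_of_one_le₀ (by linarith [sq_nonneg (k * t)]))

theorem tendsto_arctan_natCast_mul {t : ℝ} (ht : 0 < t) :
    Tendsto (fun k : ℕ => Real.arctan (k * t)) atTop (𝓝 (Real.pi / 2)) :=
  (Real.tendsto_arctan_atTop.mono_right nhdsWithin_le_nhds).comp
    (tendsto_natCast_atTop_atTop.atTop_mul_const ht)

end Arctan

section Gradient

variable {E : Type*} [NormedAddCommGroup E] [InnerProductSpace ℝ E] [CompleteSpace E]
  {f g : E → ℝ} {x : E}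

theorem gradient_eq_of_hasFDerivAt {f' : StrongDual ℝ E} (h : HasFDerivAt f f' x) :
    gradient f x = (InnerProductSpace.toDual ℝ E).symm f' :=
  (hasFDerivAt_iff_hasGradientAt.1 h).gradient

theorem gradient_add (hf : DifferentiableAt ℝ f x) (hg : DifferentiableAt ℝ g x) :
    gradient (f + g) x = gradient f x + gradient g x := by
  rw [gradient_eq_of_hasFDerivAt (hf.hasFDerivAt.add hg.hasFDerivAt), map_add]
  rfl

theorem gradient_const_smul (c : ℝ) (hf : DifferentiableAt ℝ f x) :
    gradient (c • f) x = c • gradient f x := by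
  rw [gradient_eq_of_hasFDerivAt (hf.hasFDerivAt.const_smul c)]
  simp [gradient]

theorem gradient_comp_smul (c : ℝ) (f : E → ℝ) (x : E) :
    gradient (fun y => f (c • y)) x = c • gradient f (c • x) := by
  simp [gradient, fderiv_comp_smul]

theorem gradient_comp {H : ℝ → ℝ} (hH : DifferentiableAt ℝ H (g x))
    (hg : DifferentiableAt ℝ g x) :
    gradient (fun y => H (g y)) x = deriv H (g x) • gradient g x :=
  (gradient_eq_of_hasFDerivAt (hH.hasDerivAt.comp_hasFDerivAt x hg.hasFDerivAt)).trans
    (by simp [gradient])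

theorem gradient_mul (hf : DifferentiableAt ℝ f x) (hg : DifferentiableAt ℝ g x) :
    gradient (fun y => f y * g y) x = f x • gradient g x + g x • gradient f x :=
  (gradient_eq_of_hasFDerivAt (hf.hasFDerivAt.mul hg.hasFDerivAt)).trans (by simp [gradient])

theorem gradient_mul_comp {H : ℝ → ℝ} (hf : DifferentiableAt ℝ f x)
    (hH : DifferentiableAt ℝ H (g x)) (hg : DifferentiableAt ℝ g x) :
    gradient (fun y => f y * H (g y)) x =
      H (g x) • gradient f x + deriv H (g x) • f x • gradient g x := by
  rw [gradient_mul (g := fun y => H (g y)) hf (hH.comp x hg), gradient_comp hH hg, smul_comm,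
    add_comm]

theorem gradient_inner_left (e x : E) : gradient (fun y => inner ℝ e y) x = e :=
  (gradient_eq_of_hasFDerivAt (innerSL ℝ e).hasFDerivAt).trans
    ((InnerProductSpace.toDual ℝ E).symm_apply_apply e)

theorem gradient_arctan_inner (e x : E) :
    gradient (fun y => Real.arctan (inner ℝ e y)) x = (1 + inner ℝ e x ^ 2)⁻¹ • e := by
  rw [gradient_comp (g := fun y => inner ℝ e y) (Real.differentiable_arctan _)
    (innerSL ℝ e).differentiableAt, gradient_inner_left, Real.deriv_arctan]
  simp only [one_div]

theorem continuous_gradient (hf : ContDiff ℝ 1 f) : Continuous (gradient f) :=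
  (InnerProductSpace.toDual ℝ E).symm.continuous.comp (hf.continuous_fderiv one_ne_zero)

theorem support_gradient_subset_tsupport (f : E → ℝ) : Function.support (gradient f) ⊆ tsupport f :=
  fun _ hx => support_fderiv_subset ℝ fun h => hx (by rw [gradient, h, map_zero])

theorem hasCompactSupport_gradient (hf : HasCompactSupport f) : HasCompactSupport (gradient f) :=
  hf.mono' (support_gradient_subset_tsupport f)

end Gradient

section TestFunctions

variable {N : ℕ} {Ω : Set (Euc N)} {φ ψ : Euc N → ℝ}

namespace IsTest

theorem contDiff_one (h : IsTest Ω φ) : ContDiff ℝ 1 φ :=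
  h.smooth.of_le (by simp)

theorem differentiable (h : IsTest Ω φ) : Differentiable ℝ φ :=
  h.contDiff_one.differentiable one_ne_zero

theorem memLp (h : IsTest Ω φ) (q : ENNReal) (μ : Measure (Euc N)) [IsFiniteMeasureOnCompacts μ] :
    MemLp φ q μ :=
  h.smooth.continuous.memLp_of_hasCompactSupport h.compact

theorem integrable (h : IsTest Ω φ) (μ : Measure (Euc N)) [IsFiniteMeasureOnCompacts μ] :
    Integrable φ μ :=
  memLp_one_iff_integrable.1 (h.memLp 1 μ)

theorem memLp_gradient (h : IsTest Ω φ) (q : ENNReal) (μ : Measure (Euc N))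
    [IsFiniteMeasureOnCompacts μ] : MemLp (gradient φ) q μ :=
  (continuous_gradient h.contDiff_one).memLp_of_hasCompactSupport
    (hasCompactSupport_gradient h.compact)

theorem exists_norm_le (h : IsTest Ω φ) : ∃ C, ∀ x, ‖φ x‖ ≤ C :=
  h.smooth.continuous.bounded_above_of_compact_support h.compact

theorem exists_norm_gradient_le (h : IsTest Ω φ) : ∃ C, ∀ x, ‖gradient φ x‖ ≤ C :=
  (continuous_gradient h.contDiff_one).bounded_above_of_compact_support
    (hasCompactSupport_gradient h.compact)

theorem integrable_inner_gradient (h : IsTest Ω φ) {μ : Measure (Euc N)} {σ : Euc N → Euc N}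
    (hσ : Integrable σ μ) : Integrable (fun x => inner ℝ (gradient φ x) (σ x)) μ := by
  obtain ⟨C, hC⟩ := h.exists_norm_gradient_le
  have hφ' := continuous_gradient h.contDiff_one
  refine (hσ.norm.const_mul C).mono' (hφ'.aestronglyMeasurable.inner hσ.1) (.of_forall fun x => ?_)
  calc ‖inner ℝ (gradient φ x) (σ x)‖ ≤ ‖gradient φ x‖ * ‖σ x‖ := norm_inner_le_norm _ _
    _ ≤ C * ‖σ x‖ := by gcongr; exact hC x

theorem eq_zero_of_notMem (h : IsTest Ω φ) {x : Euc N} (hx : x ∉ Ω) : φ x = 0 :=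
  image_eq_zero_of_notMem_tsupport fun hx' => hx (h.supp hx')

theorem gradient_eq_zero_of_notMem (h : IsTest Ω φ) {x : Euc N} (hx : x ∉ Ω) :
    gradient φ x = 0 :=
  Function.notMem_support.1 fun hx' => hx (h.supp (support_gradient_subset_tsupport φ hx'))

theorem mul_comp (hφ : IsTest Set.univ φ) (hψ : IsTest Ω ψ) {H : ℝ → ℝ} (hH : ContDiff ℝ ∞ H)
    (hH₀ : H 0 = 0) : IsTest Ω (fun x => φ x * H (ψ x)) where
  smooth := hφ.smooth.mul (hH.comp hψ.smooth)
  compact := (hψ.compact.comp_left hH₀).mul_left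
  supp := (tsupport_mul_subset_right (f := φ) (g := H ∘ ψ)).trans
    ((closure_mono (Function.support_comp_subset hH₀ ψ)).trans hψ.supp)

theorem integral_mul_inner_gradient (hφ : IsTest Ω φ) {g : Euc N → ℝ} (hg : ContDiff ℝ 1 g)
    (e : Euc N) :
    ∫ x in Ω, g x * inner ℝ (gradient φ x) e = -∫ x in Ω, φ x * inner ℝ (gradient g x) e := by
  have hφ' := continuous_gradient hφ.contDiff_one
  have hg' := continuous_gradient hg
  have hφc := hφ.smooth.continuous
  have hgc := hg.continuous
  have hφ'_supp : HasCompactSupport fun x => inner ℝ (gradient φ x) e :=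
    (hasCompactSupport_gradient hφ.compact).comp_left (g := fun a => inner ℝ a e)
      (inner_zero_left e)
  have h := integral_mul_fderiv_eq_neg_fderiv_mul_of_integrable (μ := volume) (f := g) (g := φ)
    (v := e)
    (by
      simp only [← inner_gradient_left]
      exact Continuous.integrable_of_hasCompactSupport (by fun_prop) hφ.compact.mul_left)
    (by
      simp only [← inner_gradient_left]
      exact Continuous.integrable_of_hasCompactSupport (by fun_prop) hφ'_supp.mul_left)
    (Continuous.integrable_of_hasCompactSupport (by fun_prop) hφ.compact.mul_left)
    (fun x _ => hg.differentiable one_ne_zero x) (fun x _ => hφ.differentiable x)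
  rw [setIntegral_eq_integral_of_forall_compl_eq_zero fun x hx => by
      rw [hφ.gradient_eq_zero_of_notMem hx, inner_zero_left, mul_zero],
    setIntegral_eq_integral_of_forall_compl_eq_zero fun x hx => by
      rw [hφ.eq_zero_of_notMem hx, zero_mul]]
  simpa only [← inner_gradient_left, mul_comm (inner ℝ (gradient g _) e)] using h

end IsTest

theorem exists_isTest_one_on_closedBall (N : ℕ) (R : ℝ) : ∃ χ : Euc N → ℝ, IsTest Set.univ χ ∧
    (∀ x, 0 ≤ χ x) ∧ (∀ x, χ x ≤ 1) ∧ ∀ x, ‖x‖ ≤ R → χ x = 1 := by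
  let b : ContDiffBump (0 : Euc N) := ⟨|R| + 1, |R| + 2, by positivity, by linarith⟩
  refine ⟨b, ⟨b.contDiff, b.hasCompactSupport, Set.subset_univ _⟩, fun x => b.nonneg,
    fun x => b.le_one, fun x hx => b.one_of_mem_closedBall ?_⟩
  have hR : R ≤ |R| + 1 := (le_abs_self R).trans (by linarith)
  exact mem_closedBall_zero_iff.2 (hx.trans hR)

theorem exists_cutoff_sequence (N : ℕ) : ∃ (χ : ℕ → Euc N → ℝ) (C : ℝ),
    (∀ n, IsTest Set.univ (χ n)) ∧ (∀ n x, 0 ≤ χ n x) ∧ (∀ n x, χ n x ≤ 1) ∧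
    (∀ x, Tendsto (fun n => χ n x) atTop (𝓝 1)) ∧ ∀ n x, ‖gradient (χ n) x‖ ≤ C := by
  obtain ⟨χ, hχ, hχ₀, hχ₁, hχR⟩ := exists_isTest_one_on_closedBall N 1
  obtain ⟨C, hC⟩ := hχ.exists_norm_gradient_le
  let c : ℕ → ℝ := fun n => 1 / ((n : ℝ) + 1)
  have hc : ∀ n, 0 < c n := fun n => Nat.one_div_pos_of_nat
  have hc_lim (x : Euc N) : Tendsto (fun n => ‖c n • x‖) atTop (𝓝 0) := by
    simpa [c] using ((tendsto_one_div_add_atTop_nhds_zero_nat (𝕜 := ℝ)).smul_const x).norm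
  refine ⟨fun n x => χ (c n • x), C, fun n => ?_, fun n x => hχ₀ _, fun n x => hχ₁ _,
    fun x => ?_, fun n x => ?_⟩
  · exact ⟨hχ.smooth.comp (contDiff_id.const_smul (c n)), hχ.compact.comp_smul (hc n).ne',
      Set.subset_univ _⟩
  · refine tendsto_const_nhds.congr' ?_
    filter_upwards [(hc_lim x).eventually_le_const one_pos] with n hn
    exact (hχR _ hn).symm
  · have hc₁ : ‖c n‖ ≤ 1 := by
      rw [Real.norm_of_nonneg (hc n).le, div_le_one (by positivity)]
      linarith [n.cast_nonneg (α := ℝ)]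
    rw [gradient_comp_smul, norm_smul]
    exact (mul_le_of_le_one_left (norm_nonneg _) hc₁).trans (hC _)

end TestFunctions


section SobolevZero

variable {N : ℕ} {Ω : Set (Euc N)} {p q : ℝ} {v : Euc N → ℝ} {G : Euc N → Euc N}

/-- The pair `(v, G)` is a limit in `L^p(Ω)` of pairs `(φ, ∇φ)` with `φ` a test function: the
approximation property in the definition of `W_0^{1,p}(Ω)`. For `v` and `G` in `L^p(Ω)` it implies
that `G` is the weak gradient of `v`. -/
def IsTestLimit (Ω : Set (Euc N)) (p : ℝ) (v : Euc N → ℝ) (G : Euc N → Euc N) : Prop :=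
  ∃ φ : ℕ → Euc N → ℝ, (∀ n, IsTest Ω (φ n)) ∧
    Tendsto (fun n => eLpNorm (fun x => v x - φ n x) (ENNReal.ofReal p) (volume.restrict Ω))
      atTop (𝓝 0) ∧
    Tendsto (fun n => eLpNorm (fun x => G x - gradient (φ n) x) (ENNReal.ofReal p)
      (volume.restrict Ω)) atTop (𝓝 0)

namespace IsTestLimit

theorem integral_inner_eq (h : IsTestLimit Ω p v G) (hpq : p.HolderConjugate q)
    (hv : MemLp v (ENNReal.ofReal p) (volume.restrict Ω))
    (hG : MemLp G (ENNReal.ofReal p) (volume.restrict Ω)) {F : Euc N → Euc N} {f : Euc N → ℝ}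
    (hF : MemLp F (ENNReal.ofReal q) (volume.restrict Ω))
    (hf : MemLp f (ENNReal.ofReal q) (volume.restrict Ω))
    (hFf : ∀ φ, IsTest Ω φ → ∫ x in Ω, inner ℝ (F x) (gradient φ x) = ∫ x in Ω, f x * φ x) :
    ∫ x in Ω, inner ℝ (F x) (G x) = ∫ x in Ω, f x * v x := by
  have := hpq.symm.ennrealOfReal
  obtain ⟨φ, hφ, hφv, hφG⟩ := h
  have hlim_grad := tendsto_integral_inner hF hG (fun n => (hφ n).memLp_gradient _ _) hφG
  have hlim_val := tendsto_integral_inner hf hv (fun n => (hφ n).memLp _ _) hφv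
  simp only [RCLike.inner_apply', conj_trivial] at hlim_val
  exact tendsto_nhds_unique hlim_grad (hlim_val.congr fun n => (hFf _ (hφ n)).symm)

theorem integral_mul_inner_gradient (h : IsTestLimit Ω p v G) (hpq : p.HolderConjugate q)
    (hv : MemLp v (ENNReal.ofReal p) (volume.restrict Ω))
    (hG : MemLp G (ENNReal.ofReal p) (volume.restrict Ω)) {g : Euc N → ℝ} (hg : ContDiff ℝ 1 g)
    (hgq : MemLp g (ENNReal.ofReal q) (volume.restrict Ω))
    (hgq' : MemLp (gradient g) (ENNReal.ofReal q) (volume.restrict Ω)) (e : Euc N) :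
    ∫ x in Ω, v x * inner ℝ (gradient g x) e = -∫ x in Ω, g x * inner ℝ (G x) e := by
  have hF : MemLp (fun x => g x • e) (ENNReal.ofReal q) (volume.restrict Ω) :=
    hgq.of_le_mul (c := ‖e‖) (hgq.1.smul_const e)
      (.of_forall fun x => by rw [norm_smul, mul_comm])
  have hf : MemLp (fun x => -inner ℝ (gradient g x) e) (ENNReal.ofReal q) (volume.restrict Ω) :=
    (hgq'.inner_const e).neg
  have key := h.integral_inner_eq hpq hv hG hF hf fun φ hφ => by
    simp only [real_inner_smul_left, real_inner_comm (gradient φ _) e]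
    rw [hφ.integral_mul_inner_gradient hg e, ← integral_neg]
    simp only [neg_mul, mul_comm (φ _)]
  simp only [real_inner_smul_left, real_inner_comm (G _) e, neg_mul, integral_neg] at key
  rw [key, neg_neg]
  simp only [mul_comm]

theorem memWZero (h : IsTestLimit Ω p v G) (hpq : p.HolderConjugate q)
    (hv : MemLp v (ENNReal.ofReal p) (volume.restrict Ω))
    (hG : MemLp G (ENNReal.ofReal p) (volume.restrict Ω)) : MemWZero Ω p v G where
  memLp := hv
  memLp_grad := hG
  weakGrad _ hφ e := h.integral_mul_inner_gradient hpq hv hG hφ.contDiff_one (hφ.memLp _ _)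
    (hφ.memLp_gradient _ _) e
  approx := h

end IsTestLimit

namespace MemWZero

theorem integral_inner_eq (h : MemWZero Ω p v G) (hpq : p.HolderConjugate q)
    {F : Euc N → Euc N} {f : Euc N → ℝ}
    (hF : MemLp F (ENNReal.ofReal q) (volume.restrict Ω))
    (hf : MemLp f (ENNReal.ofReal q) (volume.restrict Ω))
    (hFf : ∀ φ, IsTest Ω φ → ∫ x in Ω, inner ℝ (F x) (gradient φ x) = ∫ x in Ω, f x * φ x) :
    ∫ x in Ω, inner ℝ (F x) (G x) = ∫ x in Ω, f x * v x :=
  IsTestLimit.integral_inner_eq h.approx hpq h.memLp h.memLp_grad hF hf hFf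

theorem exists_seq_tendsto_ae (h : MemWZero Ω p v G) (hp : 0 < p) :
    ∃ φ : ℕ → Euc N → ℝ, (∀ n, IsTest Ω (φ n)) ∧
      Tendsto (fun n => eLpNorm (fun x => G x - gradient (φ n) x) (ENNReal.ofReal p)
        (volume.restrict Ω)) atTop (𝓝 0) ∧
      ∀ᵐ x ∂volume.restrict Ω, Tendsto (fun n => φ n x) atTop (𝓝 (v x)) := by
  obtain ⟨φ, hφ, hφv, hφG⟩ := h.approx
  have hmeas : TendstoInMeasure (volume.restrict Ω) φ atTop v := by
    refine tendstoInMeasure_of_tendsto_eLpNorm (p := ENNReal.ofReal p) (by simpa using hp)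
      (fun n => ((hφ n).memLp (ENNReal.ofReal p) _).1) h.memLp.1 (hφv.congr fun n => ?_)
    exact eLpNorm_sub_comm v (φ n) _ _
  obtain ⟨ns, hns, hae⟩ := hmeas.exists_seq_tendsto_ae
  exact ⟨φ ∘ ns, fun n => hφ _, hφG.comp hns.tendsto_atTop, hae⟩

theorem isTestLimit_mul_comp (h : MemWZero Ω p v G) (hp : 1 ≤ p) {φ : Euc N → ℝ}
    (hφ : IsTest Set.univ φ) {H : ℝ → ℝ} (hH : ContDiff ℝ ∞ H) (hH₀ : H 0 = 0) {C : ℝ}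
    (hC : ∀ t, ‖H t‖ ≤ C) (hC' : ∀ t, ‖deriv H t‖ ≤ C) :
    IsTestLimit Ω p (fun x => φ x * H (v x))
      (fun x => H (v x) • gradient φ x + deriv H (v x) • φ x • G x) := by
  obtain ⟨η, hη, hηG, hη_ae⟩ := h.exists_seq_tendsto_ae (by linarith)
  obtain ⟨D, hD⟩ := hφ.exists_norm_le
  have hp₁ : 1 ≤ ENNReal.ofReal p := by simpa using hp
  have hφ_memLp := hφ.memLp (ENNReal.ofReal p) (volume.restrict Ω)
  have hφ'_memLp := hφ.memLp_gradient (ENNReal.ofReal p) (volume.restrict Ω)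
  have hη_meas n := ((hη n).memLp (ENNReal.ofReal p) (volume.restrict Ω)).1
  have hη'_memLp n := (hη n).memLp_gradient (ENNReal.ofReal p) (volume.restrict Ω)
  have hHc := hH.continuous
  have hH'c : Continuous (deriv H) := hH.continuous_deriv (by simp)
  have hφη'_memLp n := memLp_smul_of_bounded hφ_memLp.1 hD (hη'_memLp n)
  have hφG_memLp := memLp_smul_of_bounded hφ_memLp.1 hD h.memLp_grad
  have hφG_lim := tendsto_eLpNorm_smul_sub_smul hp₁ ENNReal.ofReal_ne_top (fun _ => hφ_memLp.1)
    (fun _ => hD) hφ_memLp.1 hD (.of_forall fun _ => tendsto_const_nhds) hη'_memLp h.memLp_grad hηG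
  refine ⟨fun n x => φ x * H (η n x), fun n => hφ.mul_comp (hη n) hH hH₀, ?_, ?_⟩
  · simpa only [smul_eq_mul, mul_comm] using tendsto_eLpNorm_comp_smul hp₁ ENNReal.ofReal_ne_top
      hHc hC hη_meas h.memLp.1 hη_ae (fun _ => hφ_memLp) hφ_memLp (by simp)
  · simp only [gradient_mul_comp (hφ.differentiable _) (hH.differentiable (by simp) _)
      ((hη _).differentiable _)]
    exact tendsto_eLpNorm_add_sub_add hp₁
      (fun n => memLp_smul_of_bounded (hHc.comp_aestronglyMeasurable (hη_meas n)) (fun _ => hC _)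
        hφ'_memLp)
      (memLp_smul_of_bounded (hHc.comp_aestronglyMeasurable h.memLp.1) (fun _ => hC _) hφ'_memLp)
      (fun n => memLp_smul_of_bounded (hH'c.comp_aestronglyMeasurable (hη_meas n)) (fun _ => hC' _)
        (hφη'_memLp n))
      (memLp_smul_of_bounded (hH'c.comp_aestronglyMeasurable h.memLp.1) (fun _ => hC' _)
        hφG_memLp)
      (tendsto_eLpNorm_comp_smul hp₁ ENNReal.ofReal_ne_top hHc hC hη_meas h.memLp.1 hη_ae
        (fun _ => hφ'_memLp) hφ'_memLp (by simp))
      (tendsto_eLpNorm_comp_smul hp₁ ENNReal.ofReal_ne_top hH'c hC' hη_meas h.memLp.1 hη_ae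
        hφη'_memLp hφG_memLp hφG_lim)

theorem mul_comp (h : MemWZero Ω p v G) (hpq : p.HolderConjugate q) {φ : Euc N → ℝ}
    (hφ : IsTest Set.univ φ) {H : ℝ → ℝ} (hH : ContDiff ℝ ∞ H) (hH₀ : H 0 = 0) {C : ℝ}
    (hC : ∀ t, ‖H t‖ ≤ C) (hC' : ∀ t, ‖deriv H t‖ ≤ C) :
    MemWZero Ω p (fun x => φ x * H (v x))
      (fun x => H (v x) • gradient φ x + deriv H (v x) • φ x • G x) := by
  obtain ⟨D, hD⟩ := hφ.exists_norm_le
  have hφ_memLp := hφ.memLp (ENNReal.ofReal p) (volume.restrict Ω)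
  have hHv := hH.continuous.comp_aestronglyMeasurable h.memLp.1
  have hH'v := (hH.continuous_deriv (by simp)).comp_aestronglyMeasurable h.memLp.1
  refine (h.isTestLimit_mul_comp hpq.lt.le hφ hH hH₀ hC hC').memWZero hpq ?_ ?_
  · simpa only [smul_eq_mul, mul_comm] using
      memLp_smul_of_bounded hHv (fun _ => hC _) hφ_memLp
  · exact (memLp_smul_of_bounded hHv (fun _ => hC _) (hφ.memLp_gradient _ _)).add
      (memLp_smul_of_bounded hH'v (fun _ => hC' _)
        (memLp_smul_of_bounded hφ_memLp.1 hD h.memLp_grad))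

-- The field `arctan ⟪e, x⟫ • e` is bounded and has positive bounded divergence `w`, so integrating
-- its divergence against `v` works on unbounded `Ω` as well.
theorem ae_eq_zero_of_gradient_ae_eq_zero (h : MemWZero Ω p v G) (hpq : p.HolderConjugate q)
    (hN : 1 ≤ N) (hΩ : volume Ω ≠ ⊤) (hv : ∀ᵐ x ∂volume.restrict Ω, 0 ≤ v x)
    (hG : G =ᵐ[volume.restrict Ω] 0) : v =ᵐ[volume.restrict Ω] 0 := by
  have : IsFiniteMeasure (volume.restrict Ω) := isFiniteMeasure_restrict.2 hΩ
  let e : Euc N := EuclideanSpace.single ⟨0, hN⟩ 1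
  have he : ‖e‖ = 1 := by simp [e]
  let g : Euc N → ℝ := fun x => Real.arctan (inner ℝ e x)
  let w : Euc N → ℝ := fun x => (1 + inner ℝ e x ^ 2)⁻¹
  have hw₀ (x : Euc N) : 0 < w x := by positivity
  have hw₁ (x : Euc N) : w x ≤ 1 := inv_le_one_of_one_le₀ (by linarith [sq_nonneg (inner ℝ e x)])
  have hw_cont : Continuous w := by fun_prop (disch := intro; positivity)
  have hg : ContDiff ℝ 1 g := Real.contDiff_arctan.comp (innerSL ℝ e).contDiff
  have hg' (x : Euc N) : gradient g x = w x • e := gradient_arctan_inner e x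
  have key : ∫ x in Ω, v x * w x = 0 := by
    have h_parts := IsTestLimit.integral_mul_inner_gradient h.approx hpq h.memLp h.memLp_grad hg
      (.of_bound hg.continuous.aestronglyMeasurable _
        (.of_forall fun x => norm_arctan_le _))
      (.of_bound (continuous_gradient hg).aestronglyMeasurable 1 (.of_forall fun x => by
        rw [hg', norm_smul, he, mul_one, Real.norm_of_nonneg (hw₀ x).le]
        exact hw₁ x)) e
    have h_zero : ∫ x in Ω, g x * inner ℝ (G x) e = 0 :=
      integral_eq_zero_of_ae (hG.mono fun x hx => by simp [hx])
    simpa only [hg', real_inner_smul_left, real_inner_self_eq_norm_sq, he, one_pow, mul_one,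
      h_zero, neg_zero] using h_parts
  have hvw : Integrable (fun x => v x * w x) (volume.restrict Ω) :=
    (h.memLp.integrable (by simpa using hpq.lt.le)).mul_bdd hw_cont.aestronglyMeasurable
      (.of_forall fun x => (Real.norm_of_nonneg (hw₀ x).le).trans_le (hw₁ x))
  rw [integral_eq_zero_iff_of_nonneg_ae (hv.mono fun x hx => mul_nonneg hx (hw₀ x).le) hvw] at key
  exact key.mono fun x hx => (mul_eq_zero.1 hx).resolve_right (hw₀ x).ne'

end MemWZero

end SobolevZero

section PositiveFunctionals

open CompactlySupported

theorem exists_isFiniteMeasureOnCompacts_integral_eq {X : Type*} [TopologicalSpace X]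
    [LocallyCompactSpace X] [T2Space X] [MeasurableSpace X] [BorelSpace X]
    (T : C_c(X, ℝ) →ₗ.[ℝ] ℝ) (hT : ∀ f : T.domain, 0 ≤ (f : C_c(X, ℝ)) → 0 ≤ T f)
    (hdom : ∀ f : C_c(X, ℝ), ∃ g : T.domain, f ≤ g) :
    ∃ ν : Measure X, IsFiniteMeasureOnCompacts ν ∧
      ∀ f : T.domain, ∫ x, (f : C_c(X, ℝ)) x ∂ν = T f := by
  let cone : PointedCone ℝ C_c(X, ℝ) :=
    { carrier := {f | 0 ≤ f}
      add_mem' := fun hf hg x => add_nonneg (hf x) (hg x)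
      zero_mem' := fun _ => le_rfl
      smul_mem' := fun c _ hf x => mul_nonneg c.2 (hf x) }
  obtain ⟨S, hST, hS⟩ := riesz_extension cone T hT fun f => by
    obtain ⟨g, hg⟩ := hdom (-f)
    exact ⟨g, fun x => neg_le_iff_add_nonneg.1 (hg x)⟩
  let Λ : C_c(X, ℝ) →ₚ[ℝ] ℝ := PositiveLinearMap.mk₀ S hS
  refine ⟨RealRMK.rieszMeasure Λ, inferInstance, fun f => ?_⟩
  rw [← hST f]
  exact RealRMK.integral_rieszMeasure Λ f

variable {N : ℕ}

/-- The space `C_c^∞(ℝ^N)` of test functions, as a subspace of `C_c(ℝ^N)`. Distributions are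
regarded as linear functionals on it, without a continuity requirement. -/
def testSpace (N : ℕ) : Submodule ℝ C_c(Euc N, ℝ) where
  carrier := {f | ContDiff ℝ ∞ f}
  add_mem' {f g} hf hg := (show ContDiff ℝ ∞ f from hf).add (show ContDiff ℝ ∞ g from hg)
  zero_mem' := show ContDiff ℝ ∞ fun _ => (0 : ℝ) from contDiff_const
  smul_mem' c {f} hf := (show ContDiff ℝ ∞ f from hf).const_smul c

theorem isTest_of_mem_testSpace (f : testSpace N) : IsTest Set.univ (f : C_c(Euc N, ℝ)) :=
  ⟨f.2, f.1.hasCompactSupport, Set.subset_univ _⟩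

theorem IsTest.exists_mem_testSpace {φ : Euc N → ℝ} (hφ : IsTest Set.univ φ) :
    ∃ f : testSpace N, ⇑(f : C_c(Euc N, ℝ)) = φ :=
  ⟨⟨⟨⟨φ, hφ.smooth.continuous⟩, hφ.compact⟩, hφ.smooth⟩, rfl⟩

theorem exists_testSpace_ge (f : C_c(Euc N, ℝ)) : ∃ g : testSpace N, f ≤ g := by
  obtain ⟨C, hC⟩ := f.continuous.bounded_above_of_compact_support f.hasCompactSupport
  obtain ⟨R, hR⟩ := f.hasCompactSupport.isCompact.isBounded.exists_norm_le
  obtain ⟨χ, hχ, hχ₀, -, hχR⟩ := exists_isTest_one_on_closedBall N R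
  obtain ⟨g, rfl⟩ := hχ.exists_mem_testSpace
  have hC₀ : 0 ≤ C := (norm_nonneg _).trans (hC 0)
  refine ⟨C • g, fun x => ?_⟩
  change f x ≤ C * (g : C_c(Euc N, ℝ)) x
  by_cases hx : x ∈ tsupport f
  · rw [hχR x (hR x hx), mul_one]
    exact (le_abs_self _).trans (hC x)
  · rw [image_eq_zero_of_notMem_tsupport hx]
    exact mul_nonneg hC₀ (hχ₀ x)

theorem exists_isFiniteMeasureOnCompacts_of_testSpace_nonneg (T : testSpace N →ₗ[ℝ] ℝ)
    (hT : ∀ f : testSpace N, 0 ≤ (f : C_c(Euc N, ℝ)) → 0 ≤ T f) :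
    ∃ ν : Measure (Euc N), IsFiniteMeasureOnCompacts ν ∧
      ∀ f : testSpace N, ∫ x, (f : C_c(Euc N, ℝ)) x ∂ν = T f :=
  exists_isFiniteMeasureOnCompacts_integral_eq ⟨testSpace N, T⟩ hT exists_testSpace_ge

/-- The distribution `μ + div σ`, acting on test functions. -/
def measureAddDiv (μ : Measure (Euc N)) [IsFiniteMeasureOnCompacts μ] {σ : Euc N → Euc N}
    (hσ : Integrable σ) : testSpace N →ₗ[ℝ] ℝ where
  toFun f := ∫ x, (f : C_c(Euc N, ℝ)) x ∂μ - ∫ x, inner ℝ (gradient (f : C_c(Euc N, ℝ)) x) (σ x)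
  map_add' f g := by
    have hf := isTest_of_mem_testSpace f
    have hg := isTest_of_mem_testSpace g
    simp only [Submodule.coe_add, CompactlySupportedContinuousMap.coe_add, Pi.add_apply,
      gradient_add (hf.differentiable _) (hg.differentiable _), inner_add_left]
    rw [integral_add (hf.integrable μ) (hg.integrable μ),
      integral_add (hf.integrable_inner_gradient hσ) (hg.integrable_inner_gradient hσ)]
    ring
  map_smul' c f := by
    simp only [Submodule.coe_smul, CompactlySupportedContinuousMap.coe_smul, Pi.smul_apply,
      gradient_const_smul c ((isTest_of_mem_testSpace f).differentiable _), real_inner_smul_left,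
      smul_eq_mul, integral_const_mul, RingHom.id_apply]
    ring

theorem isFiniteMeasure_of_integral_eq_sub {μ ν : Measure (Euc N)} [IsFiniteMeasure μ]
    [IsFiniteMeasureOnCompacts ν] {σ : Euc N → Euc N} (hσ : Integrable σ)
    (h : ∀ φ, IsTest Set.univ φ →
      ∫ x, φ x ∂ν = ∫ x, φ x ∂μ - ∫ x, inner ℝ (gradient φ x) (σ x)) :
    IsFiniteMeasure ν := by
  obtain ⟨χ, C, hχ, hχ₀, hχ₁, hχ_lim, hχC⟩ := exists_cutoff_sequence N
  refine isFiniteMeasure_of_tendsto_one (C := μ.real Set.univ + C * ∫ x, ‖σ x‖)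
    (fun n => (hχ n).integrable ν) hχ₀ (.of_forall hχ_lim) fun n => ?_
  have h_mass : ∫ x, χ n x ∂μ ≤ μ.real Set.univ := by
    simpa using integral_mono ((hχ n).integrable μ) (integrable_const 1) (hχ₁ n)
  have h_flux : -∫ x, inner ℝ (gradient (χ n) x) (σ x) ≤ C * ∫ x, ‖σ x‖ := by
    rw [← integral_neg, ← integral_const_mul]
    refine integral_mono ((hχ n).integrable_inner_gradient hσ).neg (hσ.norm.const_mul C)
      fun x => ?_
    calc -inner ℝ (gradient (χ n) x) (σ x) ≤ ‖gradient (χ n) x‖ * ‖σ x‖ :=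
          (neg_le_abs _).trans (abs_real_inner_le_norm _ _)
      _ ≤ C * ‖σ x‖ := by gcongr; exact hχC n x
  rw [h _ (hχ n)]
  linarith

theorem negDivIsFiniteMeasure_of_integral_inner_le {μ : Measure (Euc N)} [IsFiniteMeasure μ]
    {σ : Euc N → Euc N} (hσ : Integrable σ)
    (h : ∀ φ, IsTest Set.univ φ → (∀ x, 0 ≤ φ x) →
      ∫ x, inner ℝ (gradient φ x) (σ x) ≤ ∫ x, φ x ∂μ) :
    NegDivIsFiniteMeasure σ := by
  obtain ⟨ν, _, hν⟩ := exists_isFiniteMeasureOnCompacts_of_testSpace_nonneg (measureAddDiv μ hσ)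
    fun f hf => sub_nonneg.2 (h _ (isTest_of_mem_testSpace f) hf)
  have hν_test (φ : Euc N → ℝ) (hφ : IsTest Set.univ φ) :
      ∫ x, φ x ∂ν = ∫ x, φ x ∂μ - ∫ x, inner ℝ (gradient φ x) (σ x) := by
    obtain ⟨f, rfl⟩ := hφ.exists_mem_testSpace
    exact hν f
  refine ⟨μ, ν, inferInstance, isFiniteMeasure_of_integral_eq_sub hσ hν_test, fun φ hφ => ?_⟩
  rw [hν_test φ hφ, sub_sub_cancel]

end PositiveFunctionals

section Eigenfunctions

variable {N : ℕ} {Ω : Set (Euc N)} {p q lam : ℝ} {u v φ : Euc N → ℝ} {G Gv : Euc N → Euc N}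

namespace IsEigenfunction

theorem integral_inner_dualityMap_gradient (h : IsEigenfunction Ω p lam u G) (hφ : IsTest Ω φ) :
    ∫ x in Ω, inner ℝ (dualityMap p (G x)) (gradient φ x) =
      lam * ∫ x in Ω, dualityMap p (u x) * φ x := by
  simpa only [dualityMap, real_inner_smul_left, smul_eq_mul, Real.norm_eq_abs] using h.weakEq φ hφ

theorem integral_inner_dualityMap (h : IsEigenfunction Ω p lam u G) (hpq : p.HolderConjugate q)
    (hv : MemWZero Ω p v Gv) :
    ∫ x in Ω, inner ℝ (dualityMap p (G x)) (Gv x) = lam * ∫ x in Ω, dualityMap p (u x) * v x := by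
  rw [← integral_const_mul]
  simp only [← mul_assoc]
  refine hv.integral_inner_eq hpq (memLp_dualityMap hpq h.mem.memLp_grad)
    ((memLp_dualityMap hpq h.mem.memLp).const_mul lam) fun φ hφ => ?_
  simp only [h.integral_inner_dualityMap_gradient hφ, mul_assoc, integral_const_mul]

theorem integral_norm_rpow (h : IsEigenfunction Ω p lam u G) (hpq : p.HolderConjugate q) :
    ∫ x in Ω, ‖G x‖ ^ p = lam * ∫ x in Ω, ‖u x‖ ^ p := by
  simpa only [inner_dualityMap_self hpq.ne_zero, dualityMap_mul_self hpq.ne_zero] using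
    h.integral_inner_dualityMap hpq h.mem

theorem eigenvalue_pos (h : IsEigenfunction Ω p lam u G) (hpq : p.HolderConjugate q) (hN : 1 ≤ N)
    (hΩ : volume Ω ≠ ⊤) (hu : ∀ᵐ x ∂volume.restrict Ω, 0 ≤ u x) : 0 < lam := by
  by_contra! hlam
  have h_energy : ∫ x in Ω, ‖G x‖ ^ p = 0 := by
    refine le_antisymm ?_ (integral_nonneg fun x => by positivity)
    rw [h.integral_norm_rpow hpq]
    exact mul_nonpos_of_nonpos_of_nonneg hlam (integral_nonneg fun x => by positivity)
  rw [integral_eq_zero_iff_of_nonneg (fun x => by positivity)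
    (integrable_norm_rpow_of_memLp hpq.pos h.mem.memLp_grad)] at h_energy
  have hG : G =ᵐ[volume.restrict Ω] 0 := h_energy.mono fun x hx =>
    norm_eq_zero.1 ((Real.rpow_eq_zero_iff_of_nonneg (norm_nonneg _)).1 hx).1
  exact h.nonzero (h.mem.ae_eq_zero_of_gradient_ae_eq_zero hpq hN hΩ hu hG)

theorem integral_comp_mul_inner_dualityMap_le (h : IsEigenfunction Ω p lam u G)
    (hpq : p.HolderConjugate q) (hφ : IsTest Set.univ φ) (hφ₀ : ∀ x, 0 ≤ φ x) {H : ℝ → ℝ}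
    (hH : ContDiff ℝ ∞ H) (hH₀ : H 0 = 0) {C : ℝ} (hC : ∀ t, ‖H t‖ ≤ C)
    (hC' : ∀ t, ‖deriv H t‖ ≤ C) (hH' : ∀ t, 0 ≤ deriv H t) :
    ∫ x in Ω, H (u x) * inner ℝ (dualityMap p (G x)) (gradient φ x) ≤
      lam * ∫ x in Ω, H (u x) * (dualityMap p (u x) * φ x) := by
  have := hpq.symm.ennrealOfReal
  have hφu := h.mem.mul_comp hpq hφ hH hH₀ hC hC'
  have hJG := memLp_dualityMap hpq h.mem.memLp_grad
  calc ∫ x in Ω, H (u x) * inner ℝ (dualityMap p (G x)) (gradient φ x)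
      ≤ ∫ x in Ω, inner ℝ (dualityMap p (G x))
          (H (u x) • gradient φ x + deriv H (u x) • φ x • G x) := by
        refine integral_mono (.bdd_mul (c := C) ?_ ?_ (.of_forall fun x => hC _))
          (integrable_inner_of_memLp hJG hφu.memLp_grad) fun x => ?_
        · exact integrable_inner_of_memLp hJG (hφ.memLp_gradient (ENNReal.ofReal p) _)
        · exact hH.continuous.comp_aestronglyMeasurable h.mem.memLp.1
        · simp only [inner_add_right, real_inner_smul_right, inner_dualityMap_self hpq.ne_zero]
          have := hH' (u x)
          have := hφ₀ x
          exact le_add_of_nonneg_right (by positivity)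
    _ = lam * ∫ x in Ω, dualityMap p (u x) * (φ x * H (u x)) :=
        h.integral_inner_dualityMap hpq hφu
    _ = lam * ∫ x in Ω, H (u x) * (dualityMap p (u x) * φ x) := by
        congr! 3 with x
        ring

theorem integral_inner_dualityMap_gradient_le (h : IsEigenfunction Ω p lam u G)
    (hpq : p.HolderConjugate q) (hu : ∀ᵐ x ∂volume.restrict Ω, 0 < u x)
    (hφ : IsTest Set.univ φ) (hφ₀ : ∀ x, 0 ≤ φ x) :
    ∫ x in Ω, inner ℝ (dualityMap p (G x)) (gradient φ x) ≤
      lam * ∫ x in Ω, dualityMap p (u x) * φ x := by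
  have := hpq.symm.ennrealOfReal
  have hmeas (k : ℕ) :
      AEStronglyMeasurable (fun x => Real.arctan (k * u x)) (volume.restrict Ω) :=
    (Real.continuous_arctan.comp (continuous_const_mul _)).comp_aestronglyMeasurable h.mem.memLp.1
  have hlim : ∀ᵐ x ∂volume.restrict Ω,
      Tendsto (fun k : ℕ => Real.arctan (k * u x)) atTop (𝓝 (Real.pi / 2)) :=
    hu.mono fun x hx => tendsto_arctan_natCast_mul hx
  have hlim_left := tendsto_integral_mul_of_bounded
    (integrable_inner_of_memLp (memLp_dualityMap hpq h.mem.memLp_grad)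
      (hφ.memLp_gradient (ENNReal.ofReal p) _)) hmeas (fun _ _ => norm_arctan_le _) hlim
  have hlim_right := tendsto_integral_mul_of_bounded
    ((memLp_dualityMap hpq h.mem.memLp).integrable_mul
      (hφ.memLp (ENNReal.ofReal p) _)) hmeas (fun _ _ => norm_arctan_le _) hlim
  have hle := le_of_tendsto_of_tendsto' hlim_left (hlim_right.const_mul lam) fun k =>
    h.integral_comp_mul_inner_dualityMap_le hpq hφ hφ₀
      (Real.contDiff_arctan.comp (contDiff_const.mul contDiff_id)) (by simp)
      (fun t => (norm_arctan_le _).trans (le_max_left _ ‖(k : ℝ)‖))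
      (fun t => (norm_deriv_arctan_const_mul_le _ t).trans (le_max_right _ _))
      (deriv_arctan_const_mul_nonneg k.cast_nonneg)
  rw [integral_const_mul, integral_const_mul, mul_left_comm] at hle
  exact le_of_mul_le_mul_left hle (by positivity)

end IsEigenfunction

end Eigenfunctions

section Duality

variable {N : ℕ} {Ω : Set (Euc N)} {p q lam : ℝ} {f g u v : Euc N → ℝ} {G σ : Euc N → Euc N}

theorem MemWZero.integral_mul_le_of_negDivEq (hv : MemWZero Ω p v G) (hpq : p.HolderConjugate q)
    (hlam : 0 < lam) (hf : MemLp f (ENNReal.ofReal q) (volume.restrict Ω))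
    (hσ : MemLp σ (ENNReal.ofReal q)) (hdiv : NegDivEq Ω σ f) :
    ∫ x in Ω, f x * v x ≤ 1 / (p * lam) * (∫ x in Ω, ‖G x‖ ^ p) +
      1 / q * lam ^ (q - 1) * ∫ x in closure Ω, ‖σ x‖ ^ q := by
  have := hpq.symm.ennrealOfReal
  have hdivΩ (φ : Euc N → ℝ) (hφ : IsTest Ω φ) :
      ∫ x in Ω, inner ℝ (σ x) (gradient φ x) = ∫ x in Ω, f x * φ x := by
    rw [setIntegral_eq_integral_of_forall_compl_eq_zero fun x hx => by
      rw [hφ.gradient_eq_zero_of_notMem hx, inner_zero_right]]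
    simpa only [real_inner_comm, mul_comm] using hdiv φ hφ
  have hG_int := (integrable_norm_rpow_of_memLp hpq.pos hv.memLp_grad).const_mul (1 / (p * lam))
  have hσ_int := integrable_norm_rpow_of_memLp hpq.symm.pos hσ
  have hσ_intΩ := (hσ_int.integrableOn (s := Ω)).const_mul (1 / q * lam ^ (q - 1))
  have hq := hpq.symm.pos
  calc ∫ x in Ω, f x * v x
      = ∫ x in Ω, inner ℝ (σ x) (G x) := (hv.integral_inner_eq hpq (hσ.restrict Ω) hf hdivΩ).symm
    _ ≤ ∫ x in Ω, (1 / (p * lam) * ‖G x‖ ^ p + 1 / q * lam ^ (q - 1) * ‖σ x‖ ^ q) :=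
        integral_mono (integrable_inner_of_memLp (hσ.restrict Ω) hv.memLp_grad)
          (hG_int.add hσ_intΩ) fun x => inner_le_rpow_norm_add_rpow_norm hpq hlam (σ x) (G x)
    _ = 1 / (p * lam) * (∫ x in Ω, ‖G x‖ ^ p) +
          1 / q * lam ^ (q - 1) * ∫ x in Ω, ‖σ x‖ ^ q := by
        rw [integral_add hG_int hσ_intΩ, integral_const_mul, integral_const_mul]
    _ ≤ _ := by
        gcongr 1 / (p * lam) * _ + 1 / q * lam ^ (q - 1) * ?_
        exact setIntegral_mono_set hσ_int.integrableOn (.of_forall fun x => by positivity)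
          subset_closure.eventuallyLE

/-- The normalised flux `lam⁻¹ |∇u|^{p-2} ∇u` of a function with gradient `G = ∇u` on `Ω`, extended
by zero: the candidate minimiser of the dual problem. -/
def dualField (Ω : Set (Euc N)) (p lam : ℝ) (G : Euc N → Euc N) : Euc N → Euc N :=
  Ω.indicator fun x => lam⁻¹ • dualityMap p (G x)

theorem memLp_dualField (hΩ : MeasurableSet Ω) (hpq : p.HolderConjugate q)
    (hG : MemLp G (ENNReal.ofReal p) (volume.restrict Ω)) :
    MemLp (dualField Ω p lam G) (ENNReal.ofReal q) :=
  (memLp_indicator_iff_restrict hΩ).2 ((memLp_dualityMap hpq hG).const_smul lam⁻¹)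

theorem integrable_dualField (hΩ : MeasurableSet Ω) (hΩ_fin : volume Ω ≠ ⊤)
    (hpq : p.HolderConjugate q) (hG : MemLp G (ENNReal.ofReal p) (volume.restrict Ω)) :
    Integrable (dualField Ω p lam G) := by
  have := isFiniteMeasure_restrict.2 hΩ_fin
  exact (integrable_indicator_iff hΩ).2 (((memLp_dualityMap hpq hG).const_smul lam⁻¹).integrable
    (ENNReal.one_le_ofReal.2 hpq.symm.lt.le))

theorem integral_inner_dualField (hΩ : MeasurableSet Ω) (F : Euc N → Euc N) :
    ∫ x, inner ℝ (F x) (dualField Ω p lam G x) =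
      lam⁻¹ * ∫ x in Ω, inner ℝ (dualityMap p (G x)) (F x) := by
  rw [← integral_const_mul, ← integral_indicator hΩ]
  refine integral_congr_ae (.of_forall fun x => ?_)
  by_cases hx : x ∈ Ω
  · simp only [dualField, Set.indicator_of_mem hx, real_inner_smul_right, real_inner_comm]
  · simp only [dualField, Set.indicator_of_notMem hx, inner_zero_right]

theorem integral_norm_dualField_rpow (hΩ : MeasurableSet Ω) (hpq : p.HolderConjugate q)
    (hlam : 0 < lam) :
    ∫ x in closure Ω, ‖dualField Ω p lam G x‖ ^ q = (lam ^ q)⁻¹ * ∫ x in Ω, ‖G x‖ ^ p := by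
  have h_pow (x : Euc N) : ‖dualField Ω p lam G x‖ ^ q =
      Ω.indicator (fun x => (lam ^ q)⁻¹ * ‖G x‖ ^ p) x := by
    by_cases hx : x ∈ Ω
    · simp only [dualField, Set.indicator_of_mem hx]
      rw [norm_smul, Real.mul_rpow (norm_nonneg _) (norm_nonneg _), norm_dualityMap_rpow hpq,
        Real.norm_of_nonneg (inv_nonneg.2 hlam.le), Real.inv_rpow hlam.le]
    · simp only [dualField, Set.indicator_of_notMem hx, norm_zero,
        Real.zero_rpow hpq.symm.ne_zero]
  simp only [h_pow]
  rw [setIntegral_indicator hΩ, Set.inter_eq_self_of_subset_right subset_closure,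
    integral_const_mul]

namespace IsEigenfunction

theorem negDivEq_dualField (h : IsEigenfunction Ω p lam u G) (hΩ : MeasurableSet Ω)
    (hlam : lam ≠ 0) : NegDivEq Ω (dualField Ω p lam G) fun x => dualityMap p (u x) := by
  intro φ hφ
  rw [integral_inner_dualField hΩ, h.integral_inner_dualityMap_gradient hφ,
    inv_mul_cancel_left₀ hlam]
  simp only [mul_comm]

theorem negDivIsFiniteMeasure_dualField (h : IsEigenfunction Ω p lam u G) (hΩ : MeasurableSet Ω)
    (hΩ_fin : volume Ω ≠ ⊤) (hpq : p.HolderConjugate q) (hlam : 0 < lam)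
    (hu : ∀ᵐ x ∂volume.restrict Ω, 0 < u x) : NegDivIsFiniteMeasure (dualField Ω p lam G) := by
  have := isFiniteMeasure_restrict.2 hΩ_fin
  have hJu : Integrable (fun x => dualityMap p (u x)) (volume.restrict Ω) :=
    (memLp_dualityMap hpq h.mem.memLp).integrable (ENNReal.one_le_ofReal.2 hpq.symm.lt.le)
  have := isFiniteMeasure_withDensity_ofReal hJu.2
  refine negDivIsFiniteMeasure_of_integral_inner_le
    (μ := (volume.restrict Ω).withDensity fun x => ENNReal.ofReal (dualityMap p (u x)))
    (integrable_dualField hΩ hΩ_fin hpq h.mem.memLp_grad) fun φ hφ hφ₀ => ?_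
  have h_density : ∫ x in Ω, (ENNReal.ofReal (dualityMap p (u x))).toReal • φ x =
      ∫ x in Ω, dualityMap p (u x) * φ x := by
    refine integral_congr_ae (hu.mono fun x hx => ?_)
    have h_nonneg : 0 ≤ dualityMap p (u x) := by
      rw [dualityMap_of_pos hx]
      positivity
    simp only [ENNReal.toReal_ofReal h_nonneg, smul_eq_mul]
  rw [integral_withDensity_eq_integral_toReal_smul₀ hJu.1.aemeasurable.ennreal_ofReal
    (.of_forall fun x => ENNReal.ofReal_lt_top), h_density, integral_inner_dualField hΩ,
    inv_mul_le_iff₀ hlam]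
  exact h.integral_inner_dualityMap_gradient_le hpq hu hφ hφ₀

theorem isAdmissible_dualField (h : IsEigenfunction Ω p lam u G) (hΩ : MeasurableSet Ω)
    (hΩ_fin : volume Ω ≠ ⊤) (hpq : p.HolderConjugate q) (hlam : 0 < lam)
    (hu : ∀ᵐ x ∂volume.restrict Ω, 0 < u x) :
    IsAdmissible Ω q (fun x => dualityMap p (u x)) (dualField Ω p lam G) where
  memLp := memLp_dualField hΩ hpq h.mem.memLp_grad
  supp := .of_forall fun _ hx => Set.indicator_of_notMem (fun hx' => hx (subset_closure hx')) _
  divMeasure := h.negDivIsFiniteMeasure_dualField hΩ hΩ_fin hpq hlam hu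
  divEq := h.negDivEq_dualField hΩ hlam.ne'

theorem primalValue_self (h : IsEigenfunction Ω p lam u G) (hpq : p.HolderConjugate q)
    (hlam : lam ≠ 0) :
    1 / (p * lam) * (∫ x in Ω, ‖G x‖ ^ p) - ∫ x in Ω, dualityMap p (u x) * u x =
      -(1 / q * ∫ x in Ω, ‖u x‖ ^ p) := by
  have hp := hpq.ne_zero
  have hq : 1 / q = 1 - 1 / p := by simpa only [one_div] using hpq.one_sub_inv.symm
  simp only [dualityMap_mul_self hp, h.integral_norm_rpow hpq, hq]
  field_simp
  ring

theorem dualValue_dualField (h : IsEigenfunction Ω p lam u G) (hΩ : MeasurableSet Ω)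
    (hpq : p.HolderConjugate q) (hlam : 0 < lam) :
    1 / q * lam ^ (q - 1) * ∫ x in closure Ω, ‖dualField Ω p lam G x‖ ^ q =
      1 / q * ∫ x in Ω, ‖u x‖ ^ p := by
  have := hpq.symm.ne_zero
  have := (Real.rpow_pos_of_pos hlam q).ne'
  rw [integral_norm_dualField_rpow hΩ hpq hlam, h.integral_norm_rpow hpq,
    Real.rpow_sub_one hlam.ne']
  field_simp

theorem isLeast_primalValues (h : IsEigenfunction Ω p (firstEigenvalue Ω p) u G)
    (hΩ : MeasurableSet Ω) (hpq : p.HolderConjugate q) (hlam : 0 < firstEigenvalue Ω p) :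
    IsLeast (primalValues Ω p fun x => dualityMap p (u x)) (-(1 / q * ∫ x in Ω, ‖u x‖ ^ p)) := by
  refine ⟨⟨u, G, h.mem, (h.primalValue_self hpq hlam.ne').symm⟩, ?_⟩
  rintro _ ⟨v, Gv, hv, rfl⟩
  have h_weak := hv.integral_mul_le_of_negDivEq hpq hlam (memLp_dualityMap hpq h.mem.memLp)
    (memLp_dualField hΩ hpq h.mem.memLp_grad) (h.negDivEq_dualField hΩ hlam.ne')
  rw [h.dualValue_dualField hΩ hpq hlam] at h_weak
  linarith

theorem isLeast_dualValues (h : IsEigenfunction Ω p (firstEigenvalue Ω p) u G)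
    (hΩ : MeasurableSet Ω) (hΩ_fin : volume Ω ≠ ⊤) (hpq : p.HolderConjugate q)
    (hlam : 0 < firstEigenvalue Ω p) (hu : ∀ᵐ x ∂volume.restrict Ω, 0 < u x) :
    IsLeast (dualValues Ω p fun x => dualityMap p (u x)) (1 / q * ∫ x in Ω, ‖u x‖ ^ p) := by
  rw [dualValues, ← hpq.conjugate_eq]
  refine ⟨⟨_, h.isAdmissible_dualField hΩ hΩ_fin hpq hlam hu,
    (h.dualValue_dualField hΩ hpq hlam).symm⟩, ?_⟩
  rintro _ ⟨σ, hσ, rfl⟩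
  have h_weak := h.mem.integral_mul_le_of_negDivEq hpq hlam
    (memLp_dualityMap hpq h.mem.memLp) hσ.memLp hσ.divEq
  linarith [h.primalValue_self hpq hlam.ne']

end IsEigenfunction

theorem primalValues_congr (hfg : f =ᵐ[volume.restrict Ω] g) :
    primalValues Ω p f = primalValues Ω p g := by
  have h_integral (v : Euc N → ℝ) : ∫ x in Ω, f x * v x = ∫ x in Ω, g x * v x :=
    integral_congr_ae (hfg.mul .rfl)
  simp only [primalValues, h_integral]

theorem IsAdmissible.congr (h : IsAdmissible Ω q f σ) (hfg : f =ᵐ[volume.restrict Ω] g) :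
    IsAdmissible Ω q g σ where
  memLp := h.memLp
  supp := h.supp
  divMeasure := h.divMeasure
  divEq φ hφ := (h.divEq φ hφ).trans (integral_congr_ae (.mul .rfl hfg))

theorem dualValues_congr (hfg : f =ᵐ[volume.restrict Ω] g) :
    dualValues Ω p f = dualValues Ω p g :=
  Set.ext fun _ => exists_congr fun _ => and_congr_left fun _ =>
    ⟨fun h => h.congr hfg, fun h => h.congr hfg.symm⟩

end Duality

end PLaplace

end

theorem mainTheorem10_general {N : ℕ} (hN : 1 ≤ N) {Ω : Set (PLaplace.Euc N)}
    (hΩ : MeasurableSet Ω) (hΩ_fin : volume Ω ≠ ⊤) {p : ℝ} (hp : 1 < p)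
    {u : PLaplace.Euc N → ℝ} {G : PLaplace.Euc N → PLaplace.Euc N}
    (hu : PLaplace.IsEigenfunction Ω p (PLaplace.firstEigenvalue Ω p) u G)
    (hpos : ∀ᵐ x ∂volume.restrict Ω, 0 < u x) :
    IsLeast (PLaplace.primalValues Ω p (fun x => u x ^ (p - 1)))
        (-((1 - 1 / p) * ∫ x in Ω, u x ^ p)) ∧
      IsLeast (PLaplace.dualValues Ω p (fun x => u x ^ (p - 1)))
        ((1 - 1 / p) * ∫ x in Ω, u x ^ p) := by
  have hpq := Real.HolderConjugate.conjExponent hp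
  have hlam := hu.eigenvalue_pos hpq hN hΩ_fin (hpos.mono fun _ => le_of_lt)
  have hf : (fun x => u x ^ (p - 1)) =ᵐ[volume.restrict Ω] fun x => PLaplace.dualityMap p (u x) :=
    hpos.mono fun x hx => (PLaplace.dualityMap_of_pos hx).symm
  have hnorm : ∫ x in Ω, u x ^ p = ∫ x in Ω, ‖u x‖ ^ p :=
    integral_congr_ae (hpos.mono fun x hx => by simp only [Real.norm_of_nonneg hx.le])
  have hq : 1 - 1 / p = 1 / p.conjExponent := by
    simpa only [one_div] using hpq.one_sub_inv
  rw [PLaplace.primalValues_congr hf, PLaplace.dualValues_congr hf, hnorm, hq]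
  exact ⟨hu.isLeast_primalValues hΩ hpq hlam, hu.isLeast_dualValues hΩ hΩ_fin hpq hlam hpos⟩

theorem mainTheorem10 (N : ℕ) (hN : 1 ≤ N) (Ω : Set (PLaplace.Euc N)) (hΩ : IsOpen Ω)
    (hbdd : Bornology.IsBounded Ω) (p : ℝ) (hp : 1 < p)
    (u : PLaplace.Euc N → ℝ) (hu : PLaplace.IsFirstEigenfunction Ω p u) :
    ∃ m : ℝ, IsLeast (PLaplace.primalValues Ω p (fun x => u x ^ (p - 1))) m ∧
      IsLeast (PLaplace.dualValues Ω p (fun x => u x ^ (p - 1))) (-m) := by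
  obtain ⟨⟨G, hG⟩, hpos, -⟩ := hu
  have h := mainTheorem10_general hN hΩ.measurableSet hbdd.measure_lt_top.ne hp hG hpos
  exact ⟨_, h.1, by simpa only [neg_neg] using h.2⟩
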